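/- Let $n\ge 1$. Let $X_a=\bigotimes_i X^{a_i}$ and $Z_a=\bigotimes_i Z^{a_i}$ for $a\in\{0,1\}^n$, let $\mathcal Q_n$ be the set of the $4^n$ tensor products of the single-qubit Pauli operators $I,X,Y,Z$, and let $\mathcal Q_n^*=\mathcal Q_n\setminus\{I^{\otimes n}\}$. Let $S_0,\dots,S_{2^n}$ be a partition of $\mathcal Q_n^*$ into $2^n+1$ disjoint maximally commuting sets: each $S_j$ consists of $2^n-1$ pairwise commuting operators, and no further operator of $\mathcal Q_n^*$ commutes with all of $S_j$. Let $V_0,\dots,V_{2^n}$ be $n$-qubit unitary operators that diagonalize these sets, in the sense that $$S_j=\{s_{j,a}V_jZ_aV_j^\dagger \mid a\in\{0,1\}^n,\ a\ne 0\}\quad\text{with signs } s_{j,a}\in\{-1,1\}.$$ Let $\mathcal M$ be the measure-and-prepare channel that measures in the computational basis and, upon outcome $k$, prepares the uniform mixture of the other basis states: $$\mathcal M(\rho)=\sum_{k\in\{0,1\}^n}\operatorname{tr}\big[|k\rangle\langle k|\rho\big]\,\rho_k,\qquad \rho_k=\sum_{l\in\{0,1\}^n}\frac{1-\delta_{k,l}}{2^n-1}|l\rangle\langle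 l| .$$ Then the twirl of $\mathcal M$ over the uniform ensemble $\mathcal V=\{((2^n+1)^{-1},V_j^\dagger)\}_{j=0}^{2^n}$ is the depolarizing channel with zero entanglement fidelity: for all $n$-qubit operators $\rho$, $$\mathbb E_{\mathcal V}(\mathcal M)(\rho):=\frac1{2^n+1}\sum_{j=0}^{2^n}V_j\,\mathcal M(V_j^\dagger\rho V_j)\,V_j^\dagger=\mathcal D_0(\rho):=\frac1{2^{2n}-1}\sum_{P\in\mathcal Q_n^*}P\rho P .$$ An ancilla-free measure-and-prepare circuit is one that applies an $n$-qubit unitary $U$, measures the $n$ qubits in the computational basis and prepares an $n$-qubit state $\sigma_k$ depending on the outcome $k$; its channel is $\rho\mapsto\sum_k\operatorname{tr}[U^\dagger|k\rangle\langle k|U\rho]\,\sigma_k$. Each of the $2^n+1$ terms $\rho\mapsto V_j\mathcal M(V_j^\dagger\rho V_j)V_j^\dagger$ is the channel of such a circuit, and $2^n+1$ is the minimum of the numbers $K$ for which $\mathcal D_0$ is a probabilistic mixture of $K$ ancilla-free measure-and-prepare circuits; it is also the minimum over quasiprobabilistic mixtures $\mathcal D_0=\sum_{i=1}^K c_i\mathcal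 F_i$ with $c_i\in\mathbb R$, $\sum_i c_i=1$. -/

import Mathlib

open scoped Matrix ComplexOrder

noncomputable section

namespace MPDepol

/-- Bit strings of length `n`; they label the computational basis of `n` qubits. -/
abbrev Bits (n : ℕ) := Fin n → Fin 2

/-- Linear operators on the `n`-qubit Hilbert space, written in the computational basis. -/
abbrev Op (n : ℕ) := Matrix (Bits n) (Bits n) ℂ

/-- Linear maps from `n`-qubit operators to `n`-qubit operators. -/
abbrev SuperOp (n : ℕ) := Op n →ₗ[ℂ] Op n

/-- The `n`-qubit unitary group. -/
abbrev UOp (n : ℕ) := Matrix.unitaryGroup (Bits n) ℂ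

/-! ### Pauli operators -/

/-- The single-qubit Pauli operator `X`. -/
def sigmaX : Matrix (Fin 2) (Fin 2) ℂ := !![0, 1; 1, 0]

/-- The single-qubit Pauli operator `Z`. -/
def sigmaZ : Matrix (Fin 2) (Fin 2) ℂ := !![1, 0; 0, -1]

/-- The tensor product `A 0 ⊗ ⋯ ⊗ A (n - 1)` of single-qubit operators. -/
def tensor {n : ℕ} (A : Fin n → Matrix (Fin 2) (Fin 2) ℂ) : Op n :=
  Matrix.of fun k l => ∏ i, A i (k i) (l i)

/-- `X_a`, the tensor product of the `X ^ a i`. -/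
def pauliX {n : ℕ} (a : Bits n) : Op n := tensor fun i => sigmaX ^ (a i : ℕ)

/-- `Z_a`, the tensor product of the `Z ^ a i`. -/
def pauliZ {n : ℕ} (a : Bits n) : Op n := tensor fun i => sigmaZ ^ (a i : ℕ)

/-- The Pauli operator with `X`-part `x` and `Z`-part `z`, with the phase that makes it Hermitian:
since `i X Z = Y`, this is the tensor product over the qubits of `I`, `X`, `Y` or `Z` according
as `(x i, z i)` is `(0,0)`, `(1,0)`, `(1,1)` or `(0,1)`. -/
def pauli {n : ℕ} (x z : Bits n) : Op n :=
  Complex.I ^ (∑ i, (x i : ℕ) * (z i : ℕ)) • (pauliX x * pauliZ z)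

/-- The `2 ^ (2 n)` Pauli operators (tensor products of `I`, `X`, `Y`, `Z`). -/
def pauliSet (n : ℕ) : Finset (Op n) :=
  Finset.univ.image fun a : Bits n × Bits n => pauli a.1 a.2

/-- The non-identity Pauli operators. -/
def pauliStar (n : ℕ) : Finset (Op n) := (pauliSet n).erase 1

/-- `S` is a partition of the non-identity Pauli operators into `2 ^ n + 1` disjoint maximally
commuting sets of `2 ^ n - 1` operators each. -/
structure IsMaxCommutingPartition {n : ℕ} (S : Fin (2 ^ n + 1) → Finset (Op n)) : Prop where
  cover : Finset.univ.biUnion S = pauliStar n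
  disjoint : ∀ i j, i ≠ j → Disjoint (S i) (S j)
  card : ∀ j, (S j).card = 2 ^ n - 1
  commute : ∀ j, ∀ P ∈ S j, ∀ Q ∈ S j, P * Q = Q * P
  maximal : ∀ j, ∀ P ∈ pauliStar n, (∀ Q ∈ S j, P * Q = Q * P) → P ∈ S j

/-- The unitary `V` simultaneously diagonalizes the set `T` of Pauli operators:
`T = {s_a V Z_a V† | a ≠ 0}` for some signs `s_a`. -/
def Diagonalizes {n : ℕ} (V : UOp n) (T : Finset (Op n)) : Prop :=
  ∃ s : Bits n → ℂ, (∀ a, s a = 1 ∨ s a = -1) ∧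
    ∀ P : Op n, P ∈ T ↔
      ∃ a : Bits n, a ≠ 0 ∧ P = s a • ((V : Op n) * pauliZ a * (V : Op n)ᴴ)

/-! ### Channels -/

/-- Conjugation `ρ ↦ A ρ A†`. -/
def conjMap {n : ℕ} (A : Op n) : SuperOp n where
  toFun ρ := A * ρ * Aᴴ
  map_add' ρ σ := by rw [mul_add, add_mul]
  map_smul' c ρ := by simp

/-- The depolarizing channel
`φ ↦ p φ + (1 - p) / (2 ^ (2 n) - 1) ∑ P φ P`, summed over the non-identity Paulis `P`. -/
def depolarizing (n : ℕ) (p : ℝ) : SuperOp n where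
  toFun φ := (p : ℂ) • φ +
    (((1 - p) / (2 ^ (2 * n) - 1) : ℝ) : ℂ) • ∑ P ∈ pauliStar n, P * φ * P
  map_add' φ ψ := by
    simp only [mul_add, add_mul, Finset.sum_add_distrib, smul_add]
    abel
  map_smul' c φ := by
    simp only [Matrix.mul_smul, Matrix.smul_mul, ← Finset.smul_sum, smul_add, RingHom.id_apply]
    rw [smul_comm c (p : ℂ), smul_comm c]

/-- One term of a twirl: `ρ ↦ U† C(U ρ U†) U`. -/
def twirlTerm {n : ℕ} (U : UOp n) (C : SuperOp n) : SuperOp n :=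
  conjMap ((U : Op n)ᴴ) ∘ₗ C ∘ₗ conjMap (U : Op n)

/-- The twirl of `C` over the ensemble `{(p i, U i)}`: `ρ ↦ ∑ i, p i U i† C(U i ρ U i†) U i`. -/
def twirl {n : ℕ} {ι : Type*} [Fintype ι] (p : ι → ℝ) (U : ι → UOp n) (C : SuperOp n) :
    SuperOp n :=
  ∑ i, (p i : ℂ) • twirlTerm (U i) C

/-- Density operators: positive semidefinite with unit trace. -/
def IsState {n : ℕ} (ρ : Op n) : Prop := ρ.PosSemidef ∧ ρ.trace = 1

/-- The projector `|k⟩⟨k|`. -/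
def proj {n : ℕ} (k : Bits n) : Op n := Matrix.single k k 1

/-- Measure with the effects `E k` and prepare `σ k` upon outcome `k`:
`ρ ↦ ∑ k, tr[E k ρ] σ k`. -/
def measurePrepare {n : ℕ} (E σ : Bits n → Op n) : SuperOp n where
  toFun ρ := ∑ k, (E k * ρ).trace • σ k
  map_add' ρ τ := by simp [mul_add, add_smul, Finset.sum_add_distrib]
  map_smul' c ρ := by simp [Finset.smul_sum, mul_smul]

/-- The uniform mixture of the computational basis states orthogonal to `|k⟩`. -/
def otherState {n : ℕ} (k : Bits n) : Op n :=
  ∑ l : Bits n, ((1 - if k = l then 1 else 0) / (2 ^ n - 1) : ℂ) • proj l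

/-- Measure in the computational basis and, upon outcome `k`, prepare `otherState k`. -/
def mpChannel (n : ℕ) : SuperOp n := measurePrepare proj otherState

/-- `F` is the channel of an ancilla-free measure-and-prepare circuit: a unitary `U` on the `n`
input qubits, a measurement of these qubits in the computational basis (that is, of the effects
`U† |k⟩⟨k| U`), and the preparation of an arbitrary `n`-qubit state depending on the outcome. -/
def IsAncillaFreeMP {n : ℕ} (F : SuperOp n) : Prop :=
  ∃ (U : UOp n) (σ : Bits n → Op n), (∀ k, IsState (σ k)) ∧
    F = measurePrepare (fun k => (U : Op n)ᴴ * proj k * (U : Op n)) σ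

/-- `C` is a quasiprobabilistic mixture of `K` ancilla-free measure-and-prepare circuits. -/
def IsQuasiMixture {n : ℕ} (C : SuperOp n) (K : ℕ) : Prop :=
  ∃ (c : Fin K → ℝ) (F : Fin K → SuperOp n), ∑ i, c i = 1 ∧
    (∀ i, IsAncillaFreeMP (F i)) ∧ C = ∑ i, (c i : ℂ) • F i

/-- `C` is a probabilistic mixture of `K` ancilla-free measure-and-prepare circuits. -/
def IsProbMixture {n : ℕ} (C : SuperOp n) (K : ℕ) : Prop :=
  ∃ (c : Fin K → ℝ) (F : Fin K → SuperOp n), (∀ i, 0 ≤ c i) ∧ ∑ i, c i = 1 ∧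
    (∀ i, IsAncillaFreeMP (F i)) ∧ C = ∑ i, (c i : ℂ) • F i

end MPDepol

end

open scoped Matrix ComplexOrder

noncomputable section

namespace MPDepol

variable {n : ℕ}

/-! ### Tensor products and Pauli operators -/

/-! Write `d = 2 ^ n`. Summing `P ρ P` over all Paulis gives `d tr(ρ) I` (`sum_pauli_conj`), so
`D_0` sends `ρ` to `(d tr(ρ) I - ρ) / (d² - 1)`. Summing `Z_a ρ Z_a` over all `a` dephases `ρ`
(`sum_pauliZ_conj`); conjugated by `V_j`, this expresses dephasing in the basis of `V_j` through `ρ`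
and the sum of `P ρ P` over `S_j` (`sum_of_diagonalizes`). Since `M` is, up to scale, `tr(ρ) I`
minus the dephased `ρ`, adding the twirl terms over the partition reassembles the full Pauli sum,
hence `D_0`.

For minimality, `D_0` is a nonzero scalar on traceless operators, so there the outcome weights of
the `K` circuits must determine `ρ`. The weights of each circuit sum to the trace, so only `d - 1`
of them count, and `d² ≤ 1 + K (d - 1)`. The signs of the mixture coefficients play no role, so
quasiprobabilities do not help. -/

lemma sum_prod_bits (f : Fin n → Fin 2 → ℂ) :
    ∑ a : Bits n, ∏ i, f i (a i) = ∏ i, ∑ t, f i t := by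
  rw [Finset.prod_univ_sum, Fintype.piFinset_univ]

lemma prod_ite_eq_bits (k l : Bits n) :
    ∏ i, (if k i = l i then (1 : ℂ) else 0) = if k = l then 1 else 0 := by
  simp [Finset.prod_ite_zero, funext_iff]

lemma tensor_mul (A B : Fin n → Matrix (Fin 2) (Fin 2) ℂ) :
    tensor A * tensor B = tensor fun i => A i * B i := by
  ext k l
  simp only [tensor, Matrix.mul_apply, Matrix.of_apply, ← Finset.prod_mul_distrib]
  exact sum_prod_bits fun i t => A i (k i) t * B i t (l i)

lemma trace_tensor (A : Fin n → Matrix (Fin 2) (Fin 2) ℂ) :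
    (tensor A).trace = ∏ i, (A i).trace :=
  sum_prod_bits fun i t => A i t t

/-- The single-qubit Pauli operator with `X`-part `x` and `Z`-part `z`. -/
def pauliOne (x z : Fin 2) : Matrix (Fin 2) (Fin 2) ℂ :=
  Complex.I ^ ((x : ℕ) * (z : ℕ)) • (sigmaX ^ (x : ℕ) * sigmaZ ^ (z : ℕ))

lemma pauli_eq_tensor (x z : Bits n) : pauli x z = tensor fun i => pauliOne (x i) (z i) := by
  rw [pauli, pauliX, pauliZ, tensor_mul]
  ext k l
  simp [tensor, pauliOne, Finset.prod_mul_distrib, Finset.prod_pow_eq_pow_sum]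

lemma pauli_zero : pauli (0 : Bits n) 0 = 1 := by
  rw [pauli_eq_tensor]
  ext k l
  simp [tensor, pauliOne, Matrix.one_apply, prod_ite_eq_bits]

lemma pauliZ_zero : pauliZ (0 : Bits n) = 1 := by
  ext k l
  simp [tensor, pauliZ, Matrix.one_apply, prod_ite_eq_bits]

lemma trace_pauliOne_mul (x z x' z' : Fin 2) :
    (pauliOne x z * pauliOne x' z').trace = if x = x' ∧ z = z' then 2 else 0 := by
  fin_cases x <;> fin_cases z <;> fin_cases x' <;> fin_cases z' <;>
    norm_num [pauliOne, sigmaX, sigmaZ, Matrix.trace_fin_two, Matrix.one_fin_two]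

/-- Paulis with different labels are trace-orthogonal, while `P * P` has trace `2 ^ n`. This lets
sums over `pauliSet` be taken over labels. -/
lemma pauli_injective :
    Function.Injective fun a : Bits n × Bits n => pauli a.1 a.2 := by
  rintro ⟨x, z⟩ ⟨x', z'⟩ h
  have h' : (pauli x z * pauli x z).trace = (pauli x z * pauli x' z').trace := by
    rw [show pauli x z = pauli x' z' from h]
  simp only [pauli_eq_tensor, tensor_mul, trace_tensor, trace_pauliOne_mul, and_self, if_true,
    Finset.prod_ite_zero] at h'
  have hall : ∀ i ∈ Finset.univ, x i = x' i ∧ z i = z' i := by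
    by_contra hne
    rw [if_neg hne] at h'
    simp at h'
  exact Prod.ext (funext fun i => (hall i (Finset.mem_univ i)).1)
    (funext fun i => (hall i (Finset.mem_univ i)).2)

/-- The one-qubit Pauli twirl in matrix entries; its `n`-qubit form is a product over the qubits. -/
lemma sum_pauliOne_apply_mul (k k' l' l : Fin 2) :
    ∑ x, ∑ z, pauliOne x z k k' * pauliOne x z l' l =
      2 * ((if k' = l' then 1 else 0) * if k = l then 1 else 0) := by
  fin_cases k <;> fin_cases k' <;> fin_cases l' <;> fin_cases l <;>
    norm_num [pauliOne, sigmaX, sigmaZ, Matrix.one_fin_two, ← mul_assoc]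

lemma sum_sigmaZ_pow_apply_mul (k k' l' l : Fin 2) :
    ∑ a : Fin 2, (sigmaZ ^ (a : ℕ)) k k' * (sigmaZ ^ (a : ℕ)) l' l =
      2 * ((if k = k' then 1 else 0) * (if l' = l then 1 else 0) * if k = l then 1 else 0) := by
  fin_cases k <;> fin_cases k' <;> fin_cases l' <;> fin_cases l <;>
    norm_num [sigmaZ, Matrix.one_fin_two]

lemma sum_mul_mul_apply {ι : Type*} [Fintype ι] (A : ι → Op n) (ρ : Op n) (k l : Bits n) :
    (∑ a, A a * ρ * A a) k l = ∑ l', ∑ k', (∑ a, A a k k' * A a l' l) * ρ k' l' := by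
  simp only [Matrix.sum_apply, Matrix.mul_apply, Finset.sum_mul]
  rw [Finset.sum_comm]
  refine Finset.sum_congr rfl fun l' _ => ?_
  rw [Finset.sum_comm]
  exact Finset.sum_congr rfl fun k' _ => Finset.sum_congr rfl fun a _ => by ring

/-- The Pauli twirl: the sum of `P ρ P` over all Pauli operators is `2 ^ n tr(ρ) I`. -/
lemma sum_pauli_conj (ρ : Op n) :
    ∑ a : Bits n × Bits n, pauli a.1 a.2 * ρ * pauli a.1 a.2 =
      ((2 : ℂ) ^ n * ρ.trace) • (1 : Op n) := by
  have key (k k' l' l : Bits n) :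
      ∑ a : Bits n × Bits n, pauli a.1 a.2 k k' * pauli a.1 a.2 l' l =
        2 ^ n * ((if k' = l' then 1 else 0) * if k = l then 1 else 0) := by
    simp only [pauli_eq_tensor, tensor, Matrix.of_apply, ← Finset.prod_mul_distrib,
      Fintype.sum_prod_type]
    have hz (x : Bits n) := sum_prod_bits fun i t =>
      pauliOne (x i) t (k i) (k' i) * pauliOne (x i) t (l' i) (l i)
    simp only [hz]
    rw [sum_prod_bits fun i s => ∑ t, pauliOne s t (k i) (k' i) * pauliOne s t (l' i) (l i)]
    simp only [sum_pauliOne_apply_mul, Finset.prod_mul_distrib, prod_ite_eq_bits]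
    simp
  ext k l
  rw [sum_mul_mul_apply]
  simp only [key]
  simp [Matrix.one_apply, Matrix.trace, Finset.mul_sum]

/-- Dephasing: the sum of `Z_a ρ Z_a` is `2 ^ n` times the diagonal part of `ρ`. -/
lemma sum_pauliZ_conj (ρ : Op n) :
    ∑ a : Bits n, pauliZ a * ρ * pauliZ a = (2 : ℂ) ^ n • Matrix.diagonal fun k => ρ k k := by
  have key (k k' l' l : Bits n) :
      ∑ a : Bits n, pauliZ a k k' * pauliZ a l' l =
        2 ^ n * ((if k = k' then 1 else 0) * (if l' = l then 1 else 0) *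
          if k = l then 1 else 0) := by
    simp only [pauliZ, tensor, Matrix.of_apply, ← Finset.prod_mul_distrib]
    rw [sum_prod_bits fun i t =>
      (sigmaZ ^ (t : ℕ)) (k i) (k' i) * (sigmaZ ^ (t : ℕ)) (l' i) (l i)]
    simp only [sum_sigmaZ_pow_apply_mul, Finset.prod_mul_distrib, prod_ite_eq_bits]
    simp
  ext k l
  rw [sum_mul_mul_apply]
  simp only [key]
  by_cases h : k = l <;> simp [h]

lemma sum_pauliStar_conj (ρ : Op n) :
    ∑ P ∈ pauliStar n, P * ρ * P = ((2 : ℂ) ^ n * ρ.trace) • (1 : Op n) - ρ := by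
  have h1 : (1 : Op n) ∈ pauliSet n :=
    Finset.mem_image.2 ⟨(0, 0), Finset.mem_univ _, pauli_zero⟩
  have h := Finset.sum_erase_add (pauliSet n) (fun P => P * ρ * P) h1
  rw [pauliStar, eq_sub_iff_add_eq, ← sum_pauli_conj]
  simpa [pauliSet, Finset.sum_image pauli_injective.injOn] using h

lemma depolarizing_zero_apply (ρ : Op n) :
    depolarizing n 0 ρ =
      ((2 : ℂ) ^ (2 * n) - 1)⁻¹ • (((2 : ℂ) ^ n * ρ.trace) • (1 : Op n) - ρ) := by
  simp [depolarizing, sum_pauliStar_conj]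

/-! ### The twirl -/

lemma two_pow_sub_one_ne_zero (hn : 1 ≤ n) : (2 : ℂ) ^ n - 1 ≠ 0 := by
  have h : (1 : ℕ) < 2 ^ n := Nat.one_lt_two_pow (by omega)
  rw [sub_ne_zero]
  exact_mod_cast h.ne'

lemma two_pow_add_one_ne_zero : (2 : ℂ) ^ n + 1 ≠ 0 := by
  exact_mod_cast (Nat.succ_ne_zero (2 ^ n))

lemma sum_proj : ∑ k : Bits n, proj k = 1 := by
  simp only [proj, Matrix.sum_single_eq_diagonal]
  exact Matrix.diagonal_one

lemma otherState_eq (k : Bits n) :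
    otherState k = ((2 : ℂ) ^ n - 1)⁻¹ • ((1 : Op n) - proj k) := by
  rw [← sum_proj]
  simp only [otherState, div_eq_inv_mul, mul_smul, ← Finset.smul_sum, sub_smul, one_smul,
    Finset.sum_sub_distrib]
  simp

lemma trace_proj_mul (k : Bits n) (ρ : Op n) : (proj k * ρ).trace = ρ k k := by
  simp [proj, Matrix.trace_single_mul]

lemma mpChannel_apply (ρ : Op n) :
    mpChannel n ρ =
      ((2 : ℂ) ^ n - 1)⁻¹ • (ρ.trace • (1 : Op n) - Matrix.diagonal fun k => ρ k k) := by
  have h : ∑ k, ρ k k • proj k = Matrix.diagonal fun k => ρ k k := by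
    rw [← Matrix.sum_single_eq_diagonal]
    simp [proj]
  simp only [mpChannel, measurePrepare, LinearMap.coe_mk, AddHom.coe_mk, trace_proj_mul,
    otherState_eq]
  simp only [smul_comm _ ((2 : ℂ) ^ n - 1)⁻¹, ← Finset.smul_sum, smul_sub,
    Finset.sum_sub_distrib, h, ← Finset.sum_smul]
  rfl

lemma sum_of_diagonalizes {V : UOp n} {T : Finset (Op n)} (hT : T.card = 2 ^ n - 1)
    (hV : Diagonalizes V T) (ρ : Op n) :
    ρ + ∑ P ∈ T, P * ρ * P =
      (2 : ℂ) ^ n • ((V : Op n) * (Matrix.diagonal fun k => ((V : Op n)ᴴ * ρ * (V : Op n)) k k) *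
        (V : Op n)ᴴ) := by
  obtain ⟨s, hs, hmem⟩ := hV
  set f : Bits n → Op n := fun a => s a • ((V : Op n) * pauliZ a * (V : Op n)ᴴ)
  have hVV : (V : Op n) * (V : Op n)ᴴ = 1 := Matrix.mem_unitaryGroup_iff.1 V.2
  have himg : T = (Finset.univ.erase 0).image f := by
    ext P
    simp [hmem, f, eq_comm]
  -- There are `2 ^ n - 1` nonzero labels, as many as elements of `T`, so no two labels give the
  -- same operator.
  have hinj : Set.InjOn f (Finset.univ.erase (0 : Bits n) : Finset (Bits n)) := by
    rw [← Finset.card_image_iff, ← himg, hT]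
    simp [Finset.card_erase_of_mem]
  -- The sign occurs twice and squares to one.
  have hf (a : Bits n) : f a * ρ * f a =
      (V : Op n) * (pauliZ a * ((V : Op n)ᴴ * ρ * (V : Op n)) * pauliZ a) * (V : Op n)ᴴ := by
    have h2 : s a * s a = 1 := by rcases hs a with h | h <;> simp [h]
    simp only [f, Matrix.smul_mul, Matrix.mul_smul, smul_smul, h2, one_smul, Matrix.mul_assoc]
  -- The bare `ρ` supplies the term `a = 0` missing from `T`.
  have h0 : ρ =
      (V : Op n) * (pauliZ 0 * ((V : Op n)ᴴ * ρ * (V : Op n)) * pauliZ 0) * (V : Op n)ᴴ := by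
    rw [pauliZ_zero, Matrix.one_mul, Matrix.mul_one]
    simp only [← Matrix.mul_assoc, hVV, Matrix.one_mul]
    rw [Matrix.mul_assoc, hVV, Matrix.mul_one]
  rw [himg, Finset.sum_image hinj]
  simp only [hf]
  nth_rewrite 1 [h0]
  rw [add_comm, Finset.sum_erase_add _ _ (Finset.mem_univ _), ← Finset.sum_mul,
    ← Finset.mul_sum, sum_pauliZ_conj]
  simp

lemma twirlTerm_star_apply (V : UOp n) (C : SuperOp n) (ρ : Op n) :
    twirlTerm (star V) C ρ = (V : Op n) * C ((V : Op n)ᴴ * ρ * (V : Op n)) * (V : Op n)ᴴ := by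
  simp [twirlTerm, conjMap, Matrix.star_eq_conjTranspose]

lemma twirlTerm_mpChannel_apply {V : UOp n} {T : Finset (Op n)} (hT : T.card = 2 ^ n - 1)
    (hV : Diagonalizes V T) (ρ : Op n) :
    twirlTerm (star V) (mpChannel n) ρ =
      ((2 : ℂ) ^ n - 1)⁻¹ • (ρ.trace • (1 : Op n) -
        ((2 : ℂ) ^ n)⁻¹ • (ρ + ∑ P ∈ T, P * ρ * P)) := by
  have hVV : (V : Op n) * (V : Op n)ᴴ = 1 := Matrix.mem_unitaryGroup_iff.1 V.2
  have htr : ((V : Op n)ᴴ * ρ * (V : Op n)).trace = ρ.trace := by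
    rw [Matrix.trace_mul_comm, ← Matrix.mul_assoc, hVV, Matrix.one_mul]
  rw [sum_of_diagonalizes hT hV, inv_smul_smul₀ (by positivity), twirlTerm_star_apply,
    mpChannel_apply, htr]
  simp [Matrix.mul_sub, Matrix.sub_mul, hVV]

theorem twirl_mpChannel (hn : 1 ≤ n) {S : Fin (2 ^ n + 1) → Finset (Op n)}
    (hS : IsMaxCommutingPartition S) {V : Fin (2 ^ n + 1) → UOp n}
    (hV : ∀ j, Diagonalizes (V j) (S j)) :
    twirl (fun _ => ((2 ^ n + 1 : ℝ)⁻¹)) (fun j => star (V j)) (mpChannel n) =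
      depolarizing n 0 := by
  refine LinearMap.ext fun ρ => ?_
  have hsum : ∑ j, ∑ P ∈ S j, P * ρ * P = ((2 : ℂ) ^ n * ρ.trace) • (1 : Op n) - ρ := by
    rw [← sum_pauliStar_conj, ← hS.cover, Finset.sum_biUnion]
    exact fun i _ j _ hij => hS.disjoint i j hij
  have hd := two_pow_sub_one_ne_zero hn
  have hd' := two_pow_add_one_ne_zero (n := n)
  have hd'' : (2 : ℂ) ^ (2 * n) - 1 ≠ 0 := by
    rw [mul_comm, pow_mul, show ((2 : ℂ) ^ n) ^ 2 - 1 = (2 ^ n - 1) * (2 ^ n + 1) by ring]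
    exact mul_ne_zero hd hd'
  have h2 : (2 : ℂ) ^ n ≠ 0 := by positivity
  rw [depolarizing_zero_apply, twirl]
  simp only [LinearMap.sum_apply, LinearMap.smul_apply,
    fun j => twirlTerm_mpChannel_apply (hS.card j) (hV j) ρ, ← Finset.smul_sum,
    Finset.sum_sub_distrib, Finset.sum_add_distrib, hsum, Finset.sum_const, Finset.card_univ,
    Fintype.card_fin, ← Nat.cast_smul_eq_nsmul ℂ]
  ext k l
  simp only [Matrix.sub_apply, Matrix.add_apply, Matrix.smul_apply, smul_eq_mul]
  push_cast
  rw [mul_comm 2 n, pow_mul] at hd'' ⊢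
  generalize (2 : ℂ) ^ n = d at *
  field_simp
  ring

/-! ### Ancilla-free circuits -/

lemma proj_posSemidef (k : Bits n) : (proj k).PosSemidef := by
  rw [proj, ← Matrix.diagonal_single, Matrix.posSemidef_diagonal_iff]
  intro i
  by_cases h : i = k <;> simp [h]

lemma isState_otherState (hn : 1 ≤ n) (k : Bits n) : IsState (otherState k) := by
  have hd := two_pow_sub_one_ne_zero hn
  constructor
  · refine Matrix.posSemidef_sum _ fun l _ => (proj_posSemidef l).smul ?_
    have h : (0 : ℝ) ≤ (1 - if k = l then 1 else 0) / (2 ^ n - 1) := by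
      have : (1 : ℝ) ≤ 2 ^ n := one_le_pow₀ (by norm_num)
      apply div_nonneg <;> [split_ifs; skip] <;> linarith
    have h' := Complex.zero_le_real.2 h
    split_ifs at h' ⊢
    · simp
    · simpa using h'
  · rw [otherState_eq, Matrix.trace_smul, Matrix.trace_sub]
    simp [proj, hd]

lemma IsState.conj {ρ : Op n} (h : IsState ρ) (V : UOp n) :
    IsState ((V : Op n) * ρ * (V : Op n)ᴴ) := by
  refine ⟨h.1.mul_mul_conjTranspose_same _, ?_⟩
  have hVV : (V : Op n)ᴴ * (V : Op n) = 1 := Matrix.mem_unitaryGroup_iff'.1 V.2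
  rw [Matrix.trace_mul_comm, ← Matrix.mul_assoc, hVV, Matrix.one_mul, h.2]

/-- The circuit applies `V†` before measuring, and `V` is absorbed into the prepared states. -/
theorem isAncillaFreeMP_twirlTerm (hn : 1 ≤ n) (V : UOp n) :
    IsAncillaFreeMP (twirlTerm (star V) (mpChannel n)) := by
  refine ⟨star V, fun k => (V : Op n) * otherState k * (V : Op n)ᴴ,
    fun k => (isState_otherState hn k).conj V, LinearMap.ext fun ρ => ?_⟩
  rw [twirlTerm_star_apply]
  simp only [mpChannel, measurePrepare, LinearMap.coe_mk, AddHom.coe_mk, Finset.mul_sum,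
    Finset.sum_mul, Matrix.mul_smul, Matrix.smul_mul]
  refine Finset.sum_congr rfl fun k _ => ?_
  congr 1
  simp only [Unitary.coe_star, Matrix.star_eq_conjTranspose, Matrix.conjTranspose_conjTranspose,
    Matrix.mul_assoc]
  rw [Matrix.trace_mul_comm (V : Op n)]
  simp only [Matrix.mul_assoc]

lemma IsProbMixture.isQuasiMixture {C : SuperOp n} {K : ℕ} (h : IsProbMixture C K) :
    IsQuasiMixture C K := by
  obtain ⟨c, F, -, hsum, hF, hC⟩ := h
  exact ⟨c, F, hsum, hF, hC⟩

/-- On traceless operators the channel is multiplication by `-1 / (4 ^ n - 1)`. -/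
lemma depolarizing_zero_eq_zero (hn : 1 ≤ n) {ρ : Op n} (htr : ρ.trace = 0)
    (h : depolarizing n 0 ρ = 0) : ρ = 0 := by
  have hd'' : (2 : ℂ) ^ (2 * n) - 1 ≠ 0 := two_pow_sub_one_ne_zero (by omega)
  simpa [depolarizing_zero_apply, htr, hd''] using h

/-- A traceless operator is killed by an ancilla-free circuit as soon as all outcome weights but
one vanish, so a mixture of `K` circuits has rank at most `K (2 ^ n - 1)` on traceless operators. -/
theorem le_of_isQuasiMixture (hn : 1 ≤ n) {K : ℕ} (h : IsQuasiMixture (depolarizing n 0) K) :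
    2 ^ n + 1 ≤ K := by
  obtain ⟨c, F, -, hF, hC⟩ := h
  choose U σ _ hFU using hF
  let E (i : Fin K) (k : Bits n) : Op n := (U i : Op n)ᴴ * proj k * (U i : Op n)
  have hE (i : Fin K) : ∑ k, E i k = 1 := by
    have hUU : (U i : Op n)ᴴ * (U i : Op n) = 1 := Matrix.mem_unitaryGroup_iff'.1 (U i).2
    simp only [E, ← Finset.sum_mul, ← Finset.mul_sum, sum_proj, Matrix.mul_one, hUU]
  -- The trace together with all outcome weights except those of outcome `0`, which are recovered
  -- from the rest.
  let L : Op n →ₗ[ℂ] ℂ × (Fin K × {k : Bits n // k ≠ 0} → ℂ) :=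
    (Matrix.traceLinearMap (Bits n) ℂ ℂ).prod
      (LinearMap.pi fun p =>
        Matrix.traceLinearMap (Bits n) ℂ ℂ ∘ₗ LinearMap.mulLeft ℂ (E p.1 p.2))
  have hL : Function.Injective L := by
    rw [injective_iff_map_eq_zero]
    intro ρ hρ
    have htr : ρ.trace = 0 := congrArg Prod.fst hρ
    have hk (i : Fin K) (k : Bits n) (hk0 : k ≠ 0) : (E i k * ρ).trace = 0 :=
      congrFun (congrArg Prod.snd hρ) (i, ⟨k, hk0⟩)
    have h0 (i : Fin K) : (E i 0 * ρ).trace = 0 := by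
      have hs : ∑ k, (E i k * ρ).trace = 0 := by
        rw [← Matrix.trace_sum, ← Finset.sum_mul, hE, Matrix.one_mul, htr]
      rwa [Finset.sum_eq_single 0 (fun k _ hk0 => hk i k hk0) (by simp)] at hs
    refine depolarizing_zero_eq_zero hn htr ?_
    rw [hC, LinearMap.sum_apply]
    refine Finset.sum_eq_zero fun i _ => ?_
    rw [LinearMap.smul_apply, hFU]
    refine smul_eq_zero_of_right _ (Finset.sum_eq_zero fun k _ => ?_)
    refine smul_eq_zero_of_left ?_ _
    by_cases hk0 : k = 0
    · rw [hk0]; exact h0 i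
    · exact hk i k hk0
  -- Comparing dimensions: `4 ^ n ≤ 1 + K (2 ^ n - 1)`.
  have hrank := LinearMap.finrank_le_finrank_of_injective hL
  simp only [Module.finrank_matrix, Module.finrank_prod, Module.finrank_self,
    Module.finrank_fintype_fun_eq_card, Fintype.card_prod, Fintype.card_fin,
    Fintype.card_pi_const, Fintype.card_subtype_compl, Fintype.card_subtype_eq, mul_one,
    ne_eq] at hrank
  have h2 : 2 ≤ 2 ^ n := Nat.le_self_pow (by omega) 2
  obtain ⟨m, hm⟩ : ∃ m, 2 ^ n = m + 1 := ⟨2 ^ n - 1, by omega⟩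
  rw [hm] at hrank h2 ⊢
  rw [Nat.add_sub_cancel] at hrank
  by_contra hlt
  -- With `m = 2 ^ n - 1`, `K ≤ m + 1` would give `(m + 1)² ≤ 1 + (m + 1) m`, that is `m ≤ 0`.
  nlinarith [Nat.mul_le_mul_right m (show K ≤ m + 1 by omega)]

end MPDepol

end

theorem lemma1 (n : ℕ) (hn : 1 ≤ n)
    (S : Fin (2 ^ n + 1) → Finset (MPDepol.Op n)) (hS : MPDepol.IsMaxCommutingPartition S)
    (V : Fin (2 ^ n + 1) → MPDepol.UOp n) (hV : ∀ j, MPDepol.Diagonalizes (V j) (S j)) :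
    -- the twirl of the measure-and-prepare channel over the uniform ensemble of the `V j†`
    MPDepol.twirl (fun _ => ((2 ^ n + 1 : ℝ)⁻¹)) (fun j => star (V j)) (MPDepol.mpChannel n)
        = MPDepol.depolarizing n 0 ∧
    -- each of its `2 ^ n + 1` terms is an ancilla-free measure-and-prepare circuit
    (∀ j, MPDepol.IsAncillaFreeMP (MPDepol.twirlTerm (star (V j)) (MPDepol.mpChannel n))) ∧
    -- and `2 ^ n + 1` is the minimal number of such circuits, for probabilistic and for
    -- quasiprobabilistic mixtures
    IsLeast {K : ℕ | MPDepol.IsProbMixture (MPDepol.depolarizing n 0) K} (2 ^ n + 1) ∧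
    IsLeast {K : ℕ | MPDepol.IsQuasiMixture (MPDepol.depolarizing n 0) K} (2 ^ n + 1) := by
  have htwirl := MPDepol.twirl_mpChannel hn hS hV
  have hterm (j) := MPDepol.isAncillaFreeMP_twirlTerm hn (V j)
  have hprob : MPDepol.IsProbMixture (MPDepol.depolarizing n 0) (2 ^ n + 1) := by
    refine ⟨fun _ => (2 ^ n + 1 : ℝ)⁻¹, _, fun _ => by positivity, ?_, hterm, htwirl.symm⟩
    have h : (2 ^ n + 1 : ℝ) ≠ 0 := by positivity
    simp [h]
  exact ⟨htwirl, hterm,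
    ⟨hprob, fun K hK => MPDepol.le_of_isQuasiMixture hn hK.isQuasiMixture⟩,
    ⟨hprob.isQuasiMixture, fun K hK => MPDepol.le_of_isQuasiMixture hn hK⟩⟩
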